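/- Let $k$ be an algebraically closed field of characteristic $0$, let $n,p\ge 1$ be integers, write $k[x]=k[x_1,\dots,x_n]$ and $k[s]=k[s_1,\dots,s_p]$, and let $f=(f_1,\dots,f_p)\in k[x]^p$ with $F=f_1\cdots f_p$. For $A=k[x]$, or $A=k[x]_a$ the localization of $k[x]$ at (the maximal ideal of) a point $a\in k^n$, let $D_A=A\langle\partial_{x_1},\dots,\partial_{x_n}\rangle$ be the ring of differential operators with coefficients in $A$, and let $D_A[s]=D_A[s_1,\dots,s_p]$ with $s_1,\dots,s_p$ central. It acts on the free module of rank one $A[1/F,s]\cdot f^s$, where $A[s]$ acts by multiplication and $$\partial_{x_i}\cdot g f^s=\Big(\frac{\partial g}{\partial x_i}+g\sum_{j=1}^p s_j\frac{\partial f_j}{\partial x_i}f_j^{-1}\Big)f^s\qquad (g\in A[1/F,s]).$$ The Bernstein–Sato ideal of $f$ with respect to $A$ is the ideal $$\mathcal B_A(f)=\{\,b(s)\in k[s] : b(s)f^s\in D_A[s]\cdot F f^s\,\}$$ of $k[s]$. Put $\mathcal B_{glob}(f)=\mathcal B_{k[x]}(f)$ and $\mathcal B_{loc,a}(f)=\mathcal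 B_{k[x]_a}(f)$ for $a\in k^n$. Then $$\mathcal B_{glob}(f)=\bigcap_{a\in k^n}\mathcal B_{loc,a}(f).$$ -/

import Mathlib

open MvPolynomial TensorProduct

noncomputable section

namespace BernsteinSato

section Localization

variable {k A : Type*} [Field k] [CommRing A] [Algebra k A]
  (M : Submonoid A) (B : Type*) [CommRing B] [Algebra k B] [Algebra A B] [IsScalarTower k A B]
  [IsLocalization M B]

/-- The ring homomorphism `a ↦ a + ε d(a)` from `A` to the dual numbers over `B`. -/
def dualHom (d : Derivation k A A) : A →+* TrivSqZeroExt B B where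
  toFun a := TrivSqZeroExt.inl (algebraMap A B a) + TrivSqZeroExt.inr (algebraMap A B (d a))
  map_one' := by ext <;> simp
  map_zero' := by ext <;> simp
  map_add' a b := by
    ext <;> simp only [TrivSqZeroExt.fst_add, TrivSqZeroExt.snd_add, TrivSqZeroExt.fst_inl,
      TrivSqZeroExt.snd_inl, TrivSqZeroExt.fst_inr, TrivSqZeroExt.snd_inr, map_add] <;> ring
  map_mul' a b := by
    ext <;> simp only [TrivSqZeroExt.fst_add, TrivSqZeroExt.snd_add, TrivSqZeroExt.fst_inl,
      TrivSqZeroExt.snd_inl, TrivSqZeroExt.fst_inr, TrivSqZeroExt.snd_inr, TrivSqZeroExt.fst_mul,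
      TrivSqZeroExt.snd_mul, map_add, map_mul, Derivation.leibniz, smul_eq_mul,
      MulOpposite.op_add, MulOpposite.op_zero, MulOpposite.smul_eq_mul_unop,
      MulOpposite.unop_op, MulOpposite.unop_add, MulOpposite.unop_zero] <;> ring

theorem dualHom_apply (d : Derivation k A A) (a : A) : dualHom B d a =
    TrivSqZeroExt.inl (algebraMap A B a) + TrivSqZeroExt.inr (algebraMap A B (d a)) := rfl

theorem isUnit_dualHom (d : Derivation k A A) (y : M) : IsUnit (dualHom B d y) := by
  rw [TrivSqZeroExt.isUnit_iff_isUnit_fst, dualHom_apply]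
  simpa using IsLocalization.map_units B y

/-- The ring homomorphism `b ↦ b + ε d(b)` on the localization `B` of `A`. -/
def dualLift (d : Derivation k A A) : B →+* TrivSqZeroExt B B :=
  IsLocalization.lift (M := M) (isUnit_dualHom M B d)

theorem dualLift_algebraMap (d : Derivation k A A) (a : A) :
    dualLift M B d (algebraMap A B a) = dualHom B d a :=
  IsLocalization.lift_eq _ a

theorem fst_dualLift (d : Derivation k A A) (b : B) : (dualLift M B d b).fst = b := by
  have h : (TrivSqZeroExt.fstHom B B B).toRingHom.comp (dualLift M B d) = RingHom.id B := by
    apply IsLocalization.ringHom_ext M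
    ext a
    simp [dualLift_algebraMap, dualHom_apply]
  exact congrArg (fun φ : B →+* B => φ b) h

/-- The unique extension of a derivation of `A` to the localization `B = M⁻¹A`
(the quotient rule). -/
def locDeriv (d : Derivation k A A) : Derivation k B B where
  toFun b := (dualLift M B d b).snd
  map_add' x y := by simp
  map_smul' c x := by
    have h : dualLift M B d (algebraMap k B c) = TrivSqZeroExt.inl (algebraMap k B c) := by
      rw [IsScalarTower.algebraMap_apply k A B, dualLift_algebraMap]
      ext <;> simp [dualHom_apply]
    simp [Algebra.smul_def, h]
  map_one_eq_zero' := by simp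
  leibniz' x y := by simp [fst_dualLift, mul_comm]

theorem locDeriv_algebraMap (d : Derivation k A A) (a : A) :
    locDeriv M B d (algebraMap A B a) = algebraMap A B (d a) := by
  change (dualLift M B d (algebraMap A B a)).snd = _
  rw [dualLift_algebraMap, dualHom_apply, TrivSqZeroExt.snd_add, TrivSqZeroExt.snd_inl,
    TrivSqZeroExt.snd_inr, zero_add]

end Localization

/-- A derivation of a localization that vanishes on the image of `A` is zero. -/
theorem deriv_eq_zero {k A : Type*} [Field k] [CommRing A] (M : Submonoid A) (B : Type*)
    [CommRing B] [Algebra k B] [Algebra A B] [IsLocalization M B] (e : Derivation k B B)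
    (h : ∀ a : A, e (algebraMap A B a) = 0) (b : B) : e b = 0 := by
  obtain ⟨⟨a, y⟩, hb⟩ := IsLocalization.surj M b
  have h2 := congrArg e hb
  rw [e.leibniz, h, h, smul_zero, zero_add, smul_eq_mul] at h2
  exact ((IsLocalization.map_units B y).mul_right_eq_zero).1 h2

/-- A family of `n` pairwise commuting `k`-linear derivations `∂₁, …, ∂ₙ` of `A`. -/
structure CommDerivs (k A : Type*) [Field k] [CommRing A] [Algebra k A] (n : ℕ) where
  /-- the derivations -/
  d : Fin n → Derivation k A A
  comm : ∀ i j a, d i (d j a) = d j (d i a)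

/-- The extension of commuting derivations to a localization. -/
def CommDerivs.loc {k A : Type*} [Field k] [CommRing A] [Algebra k A] {n : ℕ}
    (δ : CommDerivs k A n) (M : Submonoid A) (B : Type*) [CommRing B] [Algebra k B] [Algebra A B]
    [IsScalarTower k A B] [IsLocalization M B] : CommDerivs k B n where
  d i := locDeriv M B (δ.d i)
  comm i j b := by
    have h := deriv_eq_zero M B ⁅locDeriv M B (δ.d i), locDeriv M B (δ.d j)⁆
      (fun a => by simp [Derivation.commutator_apply, locDeriv_algebraMap, δ.comm i j]) b
    rwa [Derivation.commutator_apply, sub_eq_zero] at h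

/-- The partial derivatives `∂/∂x₁, …, ∂/∂xₙ` of the polynomial ring `k[x₁, …, xₙ]`. -/
def partials (k : Type*) [Field k] (n : ℕ) : CommDerivs k (MvPolynomial (Fin n) k) n where
  d i := pderiv i
  comm i j a := by
    have h : ⁅(pderiv i : Derivation k (MvPolynomial (Fin n) k) (MvPolynomial (Fin n) k)),
        (pderiv j : Derivation k (MvPolynomial (Fin n) k) (MvPolynomial (Fin n) k))⁆ = 0 := by
      apply MvPolynomial.derivation_ext
      intro l
      classical
      simp [Derivation.commutator_apply, pderiv_X, Pi.single_apply, apply_ite]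
    have h2 := congrArg (fun e => e a) h
    simpa [Derivation.commutator_apply, sub_eq_zero] using h2

section General

variable {k A : Type*} [Field k] [CommRing A] [Algebra k A] {n p : ℕ}

/-- The defining relations of `A⟨∂₁, …, ∂ₙ⟩`: the generators `inl a` multiply and add as in the
`k`-algebra `A`, `∂ᵢ a = a ∂ᵢ + ∂ᵢ(a)`, and the `∂ᵢ` commute. -/
inductive DiffOp.Rel (δ : CommDerivs k A n) :
    FreeAlgebra k (A ⊕ Fin n) → FreeAlgebra k (A ⊕ Fin n) → Prop
  | add (a b : A) : Rel δ (FreeAlgebra.ι k (Sum.inl (a + b)))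
      (FreeAlgebra.ι k (Sum.inl a) + FreeAlgebra.ι k (Sum.inl b))
  | mul (a b : A) : Rel δ (FreeAlgebra.ι k (Sum.inl (a * b)))
      (FreeAlgebra.ι k (Sum.inl a) * FreeAlgebra.ι k (Sum.inl b))
  | scalar (c : k) : Rel δ (FreeAlgebra.ι k (Sum.inl (algebraMap k A c)))
      (algebraMap k (FreeAlgebra k (A ⊕ Fin n)) c)
  | leibniz (i : Fin n) (a : A) :
      Rel δ (FreeAlgebra.ι k (Sum.inr i) * FreeAlgebra.ι k (Sum.inl a))
        (FreeAlgebra.ι k (Sum.inl a) * FreeAlgebra.ι k (Sum.inr i)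
          + FreeAlgebra.ι k (Sum.inl (δ.d i a)))
  | comm (i j : Fin n) : Rel δ (FreeAlgebra.ι k (Sum.inr i) * FreeAlgebra.ι k (Sum.inr j))
      (FreeAlgebra.ι k (Sum.inr j) * FreeAlgebra.ι k (Sum.inr i))

/-- The ring `D_A = A⟨∂₁, …, ∂ₙ⟩` of differential operators with coefficients in `A`. -/
abbrev DiffOp (δ : CommDerivs k A n) : Type _ := RingQuot (DiffOp.Rel δ)

/-- The ring `D_A[s] = D_A[s₁, …, s_p]`, where the `s_j` are central. -/
abbrev DiffOpS (δ : CommDerivs k A n) (p : ℕ) : Type _ :=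
  DiffOp δ ⊗[k] MvPolynomial (Fin p) k

/-- The ring `A[1/F]`, with `F = f₁ ⋯ f_p`. -/
abbrev InvF (f : Fin p → A) : Type _ := Localization.Away (∏ j, f j)

/-- The free module `A[1/F, s] · f^s` of rank one; the polynomial `g` stands for `g f^s`. -/
abbrev FS (f : Fin p → A) : Type _ := MvPolynomial (Fin p) (InvF f)

theorem isUnit_f (f : Fin p → A) (j : Fin p) : IsUnit (algebraMap A (InvF f) (f j)) :=
  isUnit_of_dvd_unit (map_dvd _ (Finset.dvd_prod_of_mem f (Finset.mem_univ j)))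
    (IsLocalization.Away.algebraMap_isUnit (S := InvF f) (∏ j, f j))

/-- The inverse `f_j⁻¹` in `A[1/F]`. -/
def fInv (f : Fin p → A) (j : Fin p) : InvF f := ((isUnit_f f j).unit⁻¹ : (InvF f)ˣ)

/-- The map on `B[s]` that applies `d` to the coefficients. -/
def coeffMap {B : Type*} [CommRing B] [Algebra k B] (d : Derivation k B B) {p : ℕ}
    (g : MvPolynomial (Fin p) B) : MvPolynomial (Fin p) B :=
  ∑ m ∈ g.support, monomial m (d (coeff m g))

theorem coeff_coeffMap {B : Type*} [CommRing B] [Algebra k B] (d : Derivation k B B)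
    (g : MvPolynomial (Fin p) B) (m : Fin p →₀ ℕ) :
    coeff m (coeffMap d g) = d (coeff m g) := by
  classical
  simp only [coeffMap, coeff_sum, coeff_monomial, Finset.sum_ite_eq', mem_support_iff]
  split_ifs with h
  · rfl
  · rw [not_not.1 h, map_zero]

/-- The derivation of `B[s]` that applies `d` to the coefficients. -/
def coeffDeriv {B : Type*} [CommRing B] [Algebra k B] (d : Derivation k B B) (p : ℕ) :
    Derivation k (MvPolynomial (Fin p) B) (MvPolynomial (Fin p) B) where
  toFun g := coeffMap d g
  map_add' x y := by ext m; simp [coeff_coeffMap]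
  map_smul' c x := by ext m; simp [coeff_coeffMap]
  map_one_eq_zero' := by
    classical
    ext m
    change coeff m (coeffMap d 1) = 0
    rw [coeff_coeffMap, coeff_one]
    split_ifs <;> simp
  leibniz' x y := by
    classical
    ext m
    change coeff m (coeffMap d (x * y)) = coeff m (x * coeffMap d y + y * coeffMap d x)
    rw [coeff_coeffMap, mul_comm y, coeff_add, coeff_mul, coeff_mul, coeff_mul, map_sum,
      ← Finset.sum_add_distrib]
    refine Finset.sum_congr rfl fun q _ => ?_
    simp [coeff_coeffMap, mul_comm]

theorem coeffDeriv_C {B : Type*} [CommRing B] [Algebra k B] (d : Derivation k B B) (b : B) :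
    coeffDeriv d p (C b) = C (d b) := by
  classical
  ext m
  change coeff m (coeffMap d (C b)) = _
  rw [coeff_coeffMap, coeff_C, coeff_C]
  split_ifs <;> simp

theorem coeffDeriv_map {B : Type*} [CommRing B] [Algebra k B] (d : Derivation k B B)
    (g : MvPolynomial (Fin p) k) : coeffDeriv d p (map (algebraMap k B) g) = 0 := by
  ext m
  change coeff m (coeffMap d _) = _
  simp [coeff_coeffMap, coeff_map]

theorem coeffDeriv_comm {B : Type*} [CommRing B] [Algebra k B] (δ : CommDerivs k B n)
    (i j : Fin n) (g : MvPolynomial (Fin p) B) :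
    coeffDeriv (δ.d i) p (coeffDeriv (δ.d j) p g)
      = coeffDeriv (δ.d j) p (coeffDeriv (δ.d i) p g) := by
  ext m
  change coeff m (coeffMap _ (coeffMap _ g)) = coeff m (coeffMap _ (coeffMap _ g))
  simp only [coeff_coeffMap, δ.comm i j]

/-- The polynomial `∑ⱼ sⱼ ∂ᵢ(fⱼ) fⱼ⁻¹`, the logarithmic derivative of `f^s`. -/
def logDerivFS (δ : CommDerivs k A n) (f : Fin p → A) (i : Fin n) : FS f :=
  ∑ j, X j * C (algebraMap A (InvF f) (δ.d i (f j)) * fInv f j)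

/-- The derivations `∂ᵢ` on `A[1/F]`. -/
abbrev invDerivs (δ : CommDerivs k A n) (f : Fin p → A) : CommDerivs k (InvF f) n :=
  δ.loc (Submonoid.powers (∏ j, f j)) (InvF f)

theorem invDerivs_algebraMap (δ : CommDerivs k A n) (f : Fin p → A) (i : Fin n) (a : A) :
    (invDerivs δ f).d i (algebraMap A (InvF f) a) = algebraMap A (InvF f) (δ.d i a) :=
  locDeriv_algebraMap _ _ _ _

theorem mul_fInv (f : Fin p → A) (j : Fin p) : algebraMap A (InvF f) (f j) * fInv f j = 1 :=
  (isUnit_f f j).mul_val_inv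

theorem deriv_fInv (δ : CommDerivs k A n) (f : Fin p → A) (i : Fin n) (j : Fin p) :
    (invDerivs δ f).d i (fInv f j)
      = - (algebraMap A (InvF f) (δ.d i (f j)) * fInv f j * fInv f j) := by
  have h := congrArg ((invDerivs δ f).d i) (mul_fInv f j)
  rw [Derivation.leibniz, Derivation.map_one_eq_zero, invDerivs_algebraMap, smul_eq_mul,
    smul_eq_mul] at h
  have h2 := mul_fInv f j
  linear_combination (fInv f j) * h - ((invDerivs δ f).d i (fInv f j)) * h2

theorem coeffDeriv_logDerivFS (δ : CommDerivs k A n) (f : Fin p → A) (i j : Fin n) :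
    coeffDeriv ((invDerivs δ f).d i) p (logDerivFS δ f j)
      = coeffDeriv ((invDerivs δ f).d j) p (logDerivFS δ f i) := by
  have hX : ∀ (e : Derivation k (InvF f) (InvF f)) (l : Fin p),
      coeffDeriv e p (X l : FS f) = 0 := fun e l => by
    simpa using coeffDeriv_map e (X l : MvPolynomial (Fin p) k)
  simp only [logDerivFS, map_sum, Derivation.leibniz, hX, mul_zero, add_zero, coeffDeriv_C,
    invDerivs_algebraMap, deriv_fInv, smul_eq_mul]
  refine Finset.sum_congr rfl fun l _ => ?_
  rw [δ.comm i j]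
  congr 2
  ring

/-- The action of `∂ᵢ` on `A[1/F, s] f^s`:
`∂ᵢ · g f^s = (∂ᵢ(g) + g ∑ⱼ sⱼ ∂ᵢ(fⱼ) fⱼ⁻¹) f^s`. -/
def partialAct (δ : CommDerivs k A n) (f : Fin p → A) (i : Fin n) : Module.End k (FS f) :=
  (coeffDeriv ((invDerivs δ f).d i) p : FS f →ₗ[k] FS f) + LinearMap.mulRight k (logDerivFS δ f i)

theorem partialAct_apply (δ : CommDerivs k A n) (f : Fin p → A) (i : Fin n) (g : FS f) :
    partialAct δ f i g = coeffDeriv ((invDerivs δ f).d i) p g + g * logDerivFS δ f i := rfl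

/-- The action of the generators of `D_A` on `A[1/F, s] f^s`; those in `A` act by
multiplication. -/
def genAct (δ : CommDerivs k A n) (f : Fin p → A) : A ⊕ Fin n → Module.End k (FS f)
  | Sum.inl a => LinearMap.mulLeft k (C (algebraMap A (InvF f) a))
  | Sum.inr i => partialAct δ f i

theorem genAct_rel (δ : CommDerivs k A n) (f : Fin p → A)
    ⦃x y : FreeAlgebra k (A ⊕ Fin n)⦄ (h : DiffOp.Rel δ x y) :
    FreeAlgebra.lift k (genAct δ f) x = FreeAlgebra.lift k (genAct δ f) y := by
  apply LinearMap.ext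
  intro g
  cases h with
  | add a b => simp [genAct, add_mul]
  | mul a b => simp [genAct]
  | scalar c =>
    simp only [FreeAlgebra.lift_ι_apply, genAct, LinearMap.mulLeft_apply, AlgHom.commutes,
      Module.algebraMap_end_apply, Algebra.smul_def]
    rw [← IsScalarTower.algebraMap_apply k A (InvF f)]
    rfl
  | leibniz i a =>
    simp only [map_mul, map_add, FreeAlgebra.lift_ι_apply, genAct, Module.End.mul_apply,
      LinearMap.add_apply, LinearMap.mulLeft_apply, partialAct_apply, Derivation.leibniz,
      coeffDeriv_C, invDerivs_algebraMap, smul_eq_mul]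
    ring
  | comm i j =>
    simp only [map_mul, FreeAlgebra.lift_ι_apply, genAct, Module.End.mul_apply,
      partialAct_apply, map_add, Derivation.leibniz, smul_eq_mul]
    rw [coeffDeriv_logDerivFS δ f i j, coeffDeriv_comm]
    ring

/-- The action of `D_A` on `A[1/F, s] f^s`. -/
def actD (δ : CommDerivs k A n) (f : Fin p → A) : DiffOp δ →ₐ[k] Module.End k (FS f) :=
  RingQuot.liftAlgHom k ⟨FreeAlgebra.lift k (genAct δ f), genAct_rel δ f⟩

/-- The inclusion `k[s] → A[1/F, s]`. -/
def polyS (k : Type*) [Field k] {A : Type*} [CommRing A] [Algebra k A] {p : ℕ} (f : Fin p → A) :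
    MvPolynomial (Fin p) k →ₐ[k] FS f :=
  mapAlgHom (Algebra.ofId k (InvF f))

/-- The action of `k[s]` on `A[1/F, s] f^s`, by multiplication. -/
def actS (k : Type*) [Field k] {A : Type*} [CommRing A] [Algebra k A] {p : ℕ} (f : Fin p → A) :
    MvPolynomial (Fin p) k →ₐ[k] Module.End k (FS f) :=
  (Algebra.lmul k (FS f)).comp (polyS k f)

theorem actS_apply (f : Fin p → A) (b : MvPolynomial (Fin p) k) (g : FS f) :
    actS k f b g = polyS k f b * g := rfl

theorem actD_commute_actS (δ : CommDerivs k A n) (f : Fin p → A) (P : DiffOp δ)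
    (b : MvPolynomial (Fin p) k) : Commute (actD δ f P) (actS k f b) := by
  obtain ⟨P, rfl⟩ := RingQuot.mkAlgHom_surjective k (DiffOp.Rel δ) P
  rw [actD, RingQuot.liftAlgHom_mkAlgHom_apply]
  induction P using FreeAlgebra.induction with
  | grade0 c => rw [AlgHom.commutes]; exact Algebra.commutes c _
  | grade1 x =>
    rw [FreeAlgebra.lift_ι_apply]
    apply LinearMap.ext
    intro g
    cases x with
    | inl a =>
      simp only [genAct, Module.End.mul_apply, actS_apply, LinearMap.mulLeft_apply]
      ring
    | inr i =>
      have h : coeffDeriv ((invDerivs δ f).d i) p (polyS k f b) = 0 :=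
        coeffDeriv_map _ b
      simp only [genAct, Module.End.mul_apply, actS_apply, partialAct_apply, Derivation.leibniz,
        h, smul_eq_mul]
      ring
  | mul x y hx hy => rw [map_mul]; exact hx.mul_left hy
  | add x y hx hy => rw [map_add]; exact hx.add_left hy

/-- The action of `D_A[s]` on `A[1/F, s] f^s`. -/
def act (δ : CommDerivs k A n) (f : Fin p → A) : DiffOpS δ p →ₐ[k] Module.End k (FS f) :=
  Algebra.TensorProduct.lift (actD δ f) (actS k f) (actD_commute_actS δ f)

/-- The Bernstein–Sato ideal `B_A(f)`: the `b ∈ k[s]` such that `b(s) f^s = P · F f^s` for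
some `P ∈ D_A[s]`. -/
def bsIdeal (δ : CommDerivs k A n) (f : Fin p → A) : Ideal (MvPolynomial (Fin p) k) where
  carrier := {b | ∃ P : DiffOpS δ p,
    act δ f P (C (algebraMap A (InvF f) (∏ j, f j))) = polyS k f b}
  zero_mem' := ⟨0, by simp⟩
  add_mem' := by
    rintro b c ⟨P, hP⟩ ⟨Q, hQ⟩
    exact ⟨P + Q, by rw [map_add, map_add, LinearMap.add_apply, hP, hQ]⟩
  smul_mem' := by
    rintro c b ⟨P, hP⟩
    refine ⟨1 ⊗ₜ[k] c * P, ?_⟩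
    rw [map_mul, Module.End.mul_apply, hP, act, Algebra.TensorProduct.lift_tmul, map_one,
      one_mul, actS_apply, smul_eq_mul, map_mul]

end General

section Polynomial

variable {k : Type*} [Field k] {n p : ℕ}

/-- The global Bernstein–Sato ideal `B_{k[x]}(f)`. -/
def bsGlob (f : Fin p → MvPolynomial (Fin n) k) : Ideal (MvPolynomial (Fin p) k) :=
  bsIdeal (partials k n) f

/-- The maximal ideal of the polynomials vanishing at `a ∈ kⁿ`. -/
abbrev idealAt (a : Fin n → k) : Ideal (MvPolynomial (Fin n) k) := RingHom.ker (eval a)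

instance (a : Fin n → k) : (idealAt a).IsPrime := RingHom.ker_isPrime (eval a)

/-- The localization `k[x]_a` of `k[x]` at `a ∈ kⁿ`. -/
abbrev LocRing (a : Fin n → k) : Type _ := Localization.AtPrime (idealAt a)

/-- The partial derivatives on `k[x]_a`. -/
def locPartials (a : Fin n → k) : CommDerivs k (LocRing a) n :=
  (partials k n).loc (idealAt a).primeCompl (LocRing a)

/-- The local Bernstein–Sato ideal `B_{loc,a}(f) = B_{k[x]_a}(f)` at `a ∈ kⁿ`. -/
def bsLoc (f : Fin p → MvPolynomial (Fin n) k) (a : Fin n → k) :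
    Ideal (MvPolynomial (Fin p) k) :=
  bsIdeal (locPartials a) fun j => algebraMap (MvPolynomial (Fin n) k) (LocRing a) (f j)

end Polynomial

end BernsteinSato

end

open MvPolynomial TensorProduct

noncomputable section

namespace BernsteinSato

/-! ### Stability of `D_A[s] · F f^s` and the ideal of denominators -/

section Closure

variable {k A : Type*} [Field k] [CommRing A] [Algebra k A] {n p : ℕ}

/-! The argument moves from ideals of `k[s]` to ideals of `k[x]`. For fixed `b`, the `h ∈ k[x]` with
`h b f^s ∈ D[s] · F f^s` form an ideal (`denomIdeal`), and `b` lies in the global Bernstein–Sato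
ideal exactly when this ideal contains `1`. If `b` lies in the local ideal at `a`, clearing
denominators in the local operator gives such an `h` with `h(a) ≠ 0` (`exists_mem_denomIdeal`). If
this holds at every `a`, the ideal lies in no maximal ideal of a point, so by the weak
Nullstellensatz it is the unit ideal.

Operators are never manipulated directly. `D_A[s] · F f^s` is the smallest additive submonoid that
contains `F f^s` and is stable under `A`, `k[s]` and the `∂ᵢ` (`bsModule_le`), so both comparisons
of `A` with a localization `B` reduce to checking these stabilities. The inclusion of the global
ideal in each local one (`bsIdeal_le_loc`) holds because `A[1/F, s] f^s → B[1/F, s] f^s` commutes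
with the three kinds of generators. -/

theorem act_inl (δ : CommDerivs k A n) (f : Fin p → A) (a : A) (g : FS f) :
    act δ f (RingQuot.mkAlgHom k (DiffOp.Rel δ) (FreeAlgebra.ι k (Sum.inl a)) ⊗ₜ[k] 1) g
      = C (algebraMap A (InvF f) a) * g := by
  rw [act, Algebra.TensorProduct.lift_tmul, map_one, mul_one, actD,
    RingQuot.liftAlgHom_mkAlgHom_apply, FreeAlgebra.lift_ι_apply]
  rfl

theorem act_inr (δ : CommDerivs k A n) (f : Fin p → A) (i : Fin n) (g : FS f) :
    act δ f (RingQuot.mkAlgHom k (DiffOp.Rel δ) (FreeAlgebra.ι k (Sum.inr i)) ⊗ₜ[k] 1) g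
      = partialAct δ f i g := by
  rw [act, Algebra.TensorProduct.lift_tmul, map_one, mul_one, actD,
    RingQuot.liftAlgHom_mkAlgHom_apply, FreeAlgebra.lift_ι_apply]
  rfl

theorem act_one_tmul (δ : CommDerivs k A n) (f : Fin p → A) (b : MvPolynomial (Fin p) k)
    (g : FS f) : act δ f (1 ⊗ₜ[k] b) g = polyS k f b * g := by
  rw [act, Algebra.TensorProduct.lift_tmul, map_one, one_mul, actS_apply]

/-- An additive submonoid of `A[1/F, s] f^s` that is closed under `A`, `k[s]` and the `∂ᵢ` is
closed under `D_A[s]`. -/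
theorem act_mem (δ : CommDerivs k A n) (f : Fin p → A) (S : AddSubmonoid (FS f))
    (hA : ∀ a, ∀ g ∈ S, C (algebraMap A (InvF f) a) * g ∈ S)
    (hs : ∀ b, ∀ g ∈ S, polyS k f b * g ∈ S)
    (hd : ∀ i, ∀ g ∈ S, partialAct δ f i g ∈ S)
    (P : DiffOpS δ p) : ∀ g ∈ S, act δ f P g ∈ S := by
  have hD : ∀ Q : DiffOp δ, ∀ g ∈ S, actD δ f Q g ∈ S := by
    intro Q
    obtain ⟨Q, rfl⟩ := RingQuot.mkAlgHom_surjective k (DiffOp.Rel δ) Q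
    rw [actD, RingQuot.liftAlgHom_mkAlgHom_apply]
    induction Q using FreeAlgebra.induction with
    | grade0 c =>
      intro g hg
      rw [AlgHom.commutes, Module.algebraMap_end_apply]
      -- Scalars of `k` act as the constants of `k[s]`, so stability under `k[s]` covers them.
      have h := hs (C c) g hg
      rwa [← algebraMap_eq, AlgHom.commutes, ← Algebra.smul_def] at h
    | grade1 x =>
      intro g hg
      rw [FreeAlgebra.lift_ι_apply]
      cases x with
      | inl a => exact hA a g hg
      | inr i => exact hd i g hg
    | mul x y hx hy =>
      intro g hg
      rw [map_mul]
      exact hx _ (hy g hg)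
    | add x y hx hy =>
      intro g hg
      rw [map_add]
      exact S.add_mem (hx g hg) (hy g hg)
  induction P using TensorProduct.induction_on with
  | zero =>
    intro g _
    rw [map_zero]
    exact S.zero_mem
  | tmul Q b =>
    intro g hg
    rw [act, Algebra.TensorProduct.lift_tmul, Module.End.mul_apply]
    exact hD Q _ (hs b g hg)
  | add P Q hP hQ =>
    intro g hg
    rw [map_add]
    exact S.add_mem (hP g hg) (hQ g hg)

/-- The submodule `D_A[s] · F f^s` of `A[1/F, s] f^s`. -/
def bsModule (δ : CommDerivs k A n) (f : Fin p → A) : Submodule k (FS f) :=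
  LinearMap.range ((LinearMap.applyₗ (C (algebraMap A (InvF f) (∏ j, f j)))) ∘ₗ
    (act δ f).toLinearMap)

theorem mem_bsModule {δ : CommDerivs k A n} {f : Fin p → A} {g : FS f} :
    g ∈ bsModule δ f ↔ ∃ P, act δ f P (C (algebraMap A (InvF f) (∏ j, f j))) = g := Iff.rfl

theorem mem_bsIdeal {δ : CommDerivs k A n} {f : Fin p → A} {b : MvPolynomial (Fin p) k} :
    b ∈ bsIdeal δ f ↔ polyS k f b ∈ bsModule δ f := Iff.rfl

theorem act_mem_bsModule {δ : CommDerivs k A n} {f : Fin p → A} {g : FS f} (P : DiffOpS δ p)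
    (hg : g ∈ bsModule δ f) : act δ f P g ∈ bsModule δ f := by
  obtain ⟨Q, rfl⟩ := mem_bsModule.1 hg
  exact mem_bsModule.2 ⟨P * Q, by rw [map_mul, Module.End.mul_apply]⟩

theorem C_mul_mem_bsModule {δ : CommDerivs k A n} {f : Fin p → A} {g : FS f} (a : A)
    (hg : g ∈ bsModule δ f) : C (algebraMap A (InvF f) a) * g ∈ bsModule δ f := by
  rw [← act_inl δ]
  exact act_mem_bsModule _ hg

theorem polyS_mul_mem_bsModule {δ : CommDerivs k A n} {f : Fin p → A} {g : FS f}
    (b : MvPolynomial (Fin p) k) (hg : g ∈ bsModule δ f) :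
    polyS k f b * g ∈ bsModule δ f := by
  rw [← act_one_tmul δ]
  exact act_mem_bsModule _ hg

theorem partialAct_mem_bsModule {δ : CommDerivs k A n} {f : Fin p → A} {g : FS f} (i : Fin n)
    (hg : g ∈ bsModule δ f) : partialAct δ f i g ∈ bsModule δ f := by
  rw [← act_inr δ]
  exact act_mem_bsModule _ hg

theorem F_mem_bsModule (δ : CommDerivs k A n) (f : Fin p → A) :
    C (algebraMap A (InvF f) (∏ j, f j)) ∈ bsModule δ f :=
  mem_bsModule.2 ⟨1, by rw [map_one, Module.End.one_apply]⟩

/-- `D_A[s] · F f^s` is contained in every additive submonoid that contains `F f^s` and is closed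
under `A`, `k[s]` and the `∂ᵢ`. -/
theorem bsModule_le (δ : CommDerivs k A n) (f : Fin p → A) (S : AddSubmonoid (FS f))
    (hF : C (algebraMap A (InvF f) (∏ j, f j)) ∈ S)
    (hA : ∀ a, ∀ g ∈ S, C (algebraMap A (InvF f) a) * g ∈ S)
    (hs : ∀ b, ∀ g ∈ S, polyS k f b * g ∈ S)
    (hd : ∀ i, ∀ g ∈ S, partialAct δ f i g ∈ S) {g : FS f} (hg : g ∈ bsModule δ f) : g ∈ S := by
  obtain ⟨P, rfl⟩ := mem_bsModule.1 hg
  exact act_mem δ f S hA hs hd P _ hF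

theorem partialAct_C_mul (δ : CommDerivs k A n) (f : Fin p → A) (i : Fin n) (a : A) (g : FS f) :
    partialAct δ f i (C (algebraMap A (InvF f) a) * g)
      = C (algebraMap A (InvF f) a) * partialAct δ f i g
        + C (algebraMap A (InvF f) (δ.d i a)) * g := by
  simp only [partialAct_apply, Derivation.leibniz, coeffDeriv_C, invDerivs_algebraMap, smul_eq_mul]
  ring

/-- The elements `h` of `A` with `h b(s) f^s ∈ D_A[s] · F f^s`. -/
def denomIdeal (δ : CommDerivs k A n) (f : Fin p → A) (b : MvPolynomial (Fin p) k) : Ideal A where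
  carrier := {h | C (algebraMap A (InvF f) h) * polyS k f b ∈ bsModule δ f}
  zero_mem' := by simp
  add_mem' := by
    intro x y hx hy
    simpa [add_mul] using add_mem hx hy
  smul_mem' := by
    intro c x hx
    simpa [mul_assoc] using C_mul_mem_bsModule c hx

theorem mem_denomIdeal {δ : CommDerivs k A n} {f : Fin p → A} {b : MvPolynomial (Fin p) k}
    {h : A} : h ∈ denomIdeal δ f b ↔
      C (algebraMap A (InvF f) h) * polyS k f b ∈ bsModule δ f := Iff.rfl

/-- Membership of `b` becomes a statement about an ideal of `A`, which can be tested at maximal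
ideals. -/
theorem denomIdeal_eq_top {δ : CommDerivs k A n} {f : Fin p → A} {b : MvPolynomial (Fin p) k} :
    denomIdeal δ f b = ⊤ ↔ b ∈ bsIdeal δ f := by
  rw [Ideal.eq_top_iff_one, mem_denomIdeal, mem_bsIdeal, map_one, map_one, one_mul]

end Closure

/-! ### Base change of `A[1/F, s] f^s` along `A → B` -/

section BaseChange

variable {k A : Type*} [Field k] [CommRing A] [Algebra k A] {n p : ℕ}
  (M : Submonoid A) (B : Type*) [CommRing B] [Algebra k B] [Algebra A B] [IsScalarTower k A B]

/-- The canonical map `A[1/F] → B[1/F]`. -/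
def invMap (f : Fin p → A) : InvF f →+* InvF fun j => algebraMap A B (f j) :=
  IsLocalization.Away.lift (∏ j, f j)
    (g := (algebraMap B (InvF fun j => algebraMap A B (f j))).comp (algebraMap A B)) (by
      rw [RingHom.comp_apply, map_prod]
      exact IsLocalization.Away.algebraMap_isUnit _)

theorem invMap_algebraMap (f : Fin p → A) (a : A) :
    invMap B f (algebraMap A (InvF f) a) = algebraMap B _ (algebraMap A B a) :=
  IsLocalization.Away.lift_eq _ _ a

/-- If the numerator `a` dies in `B[1/F]`, some `F^m a` vanishes in `B`, hence in `A`, so `a` is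
already zero in `A[1/F]`. Nothing is assumed of `F`, which may be zero or a zero divisor. -/
theorem invMap_injective (f : Fin p → A) (h : Function.Injective (algebraMap A B)) :
    Function.Injective (invMap B f) := by
  rw [injective_iff_map_eq_zero]
  intro x hx
  obtain ⟨⟨a, u⟩, hu⟩ := IsLocalization.surj (Submonoid.powers (∏ j, f j)) x
  have h1 := congrArg (invMap B f) hu
  rw [map_mul, hx, zero_mul, invMap_algebraMap] at h1
  obtain ⟨⟨_, m, rfl⟩, hc⟩ := (IsLocalization.map_eq_zero_iff
    (Submonoid.powers (∏ j, algebraMap A B (f j))) _ _).1 h1.symm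
  have h2 : (∏ j, f j) ^ m * a = 0 := by
    apply h
    rw [map_mul, map_pow, map_prod, map_zero]
    exact hc
  have h3 : algebraMap A (InvF f) a = 0 :=
    (IsLocalization.map_eq_zero_iff (Submonoid.powers (∏ j, f j)) _ _).2 ⟨⟨_, m, rfl⟩, h2⟩
  exact (IsLocalization.map_units (InvF f) u).mul_left_eq_zero.1 (hu.trans h3)

/-- Both sides are inverses of the image of `f_j`, and inverses are unique. -/
theorem invMap_fInv (f : Fin p → A) (j : Fin p) :
    invMap B f (fInv f j) = fInv (fun j => algebraMap A B (f j)) j := by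
  have h1 := congrArg (invMap B f) (mul_fInv f j)
  rw [map_mul, map_one, invMap_algebraMap] at h1
  have h2 := mul_fInv (fun j => algebraMap A B (f j)) j
  linear_combination (fInv (fun j => algebraMap A B (f j)) j) * h1 - (invMap B f (fInv f j)) * h2

theorem invMap_algebraMap_field (f : Fin p → A) (c : k) :
    invMap B f (algebraMap k (InvF f) c) = algebraMap k _ c := by
  rw [IsScalarTower.algebraMap_apply k A (InvF f), invMap_algebraMap,
    ← IsScalarTower.algebraMap_apply k A B, ← IsScalarTower.algebraMap_apply k B]

/-- The canonical map `A[1/F, s] f^s → B[1/F, s] f^s`. -/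
def fsMap (f : Fin p → A) : FS f →+* FS fun j => algebraMap A B (f j) :=
  MvPolynomial.map (invMap B f)

theorem fsMap_C (f : Fin p → A) (a : A) :
    fsMap B f (C (algebraMap A (InvF f) a)) = C (algebraMap B _ (algebraMap A B a)) := by
  rw [fsMap, map_C, invMap_algebraMap]

theorem fsMap_F (f : Fin p → A) : fsMap B f (C (algebraMap A (InvF f) (∏ j, f j)))
    = C (algebraMap B _ (∏ j, algebraMap A B (f j))) := by
  rw [fsMap_C, map_prod (algebraMap A B)]

theorem fsMap_polyS (f : Fin p → A) (b : MvPolynomial (Fin p) k) :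
    fsMap B f (polyS k f b) = polyS k (fun j => algebraMap A B (f j)) b := by
  change MvPolynomial.map (invMap B f) (MvPolynomial.map _ b) = MvPolynomial.map _ b
  rw [MvPolynomial.map_map]
  have h : (invMap B f).comp (Algebra.ofId k (InvF f) : k →+* InvF f)
      = (Algebra.ofId k (InvF fun j => algebraMap A B (f j)) : k →+* _) :=
    RingHom.ext (invMap_algebraMap_field B f)
  rw [h]

/-! ### Derivations under localization, and clearing denominators -/

variable [IsLocalization M B]

/-- The two sides agree on `A`. Applying the Leibniz rule to `x u = a`, with `u` a power of `F`,
extends this to fractions, since the image of `u` is a unit. -/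
theorem invMap_invDerivs (δ : CommDerivs k A n) (f : Fin p → A) (i : Fin n) (x : InvF f) :
    invMap B f ((invDerivs δ f).d i x)
      = (invDerivs (δ.loc M B) fun j => algebraMap A B (f j)).d i (invMap B f x) := by
  have key : ∀ a : A, invMap B f ((invDerivs δ f).d i (algebraMap A (InvF f) a))
      = (invDerivs (δ.loc M B) fun j => algebraMap A B (f j)).d i
        (invMap B f (algebraMap A (InvF f) a)) := by
    intro a
    rw [invDerivs_algebraMap, invMap_algebraMap, invMap_algebraMap, invDerivs_algebraMap]
    exact congrArg _ (locDeriv_algebraMap M B (δ.d i) a).symm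
  obtain ⟨⟨a, u⟩, hu⟩ := IsLocalization.surj (Submonoid.powers (∏ j, f j)) x
  have hu' := (IsLocalization.map_units (InvF f) u).map (invMap B f)
  have h1 := congrArg (fun y => invMap B f ((invDerivs δ f).d i y)) hu
  have h2 := congrArg (fun y => (invDerivs (δ.loc M B) fun j => algebraMap A B (f j)).d i
    (invMap B f y)) hu
  simp only [Derivation.leibniz, smul_eq_mul, map_add, map_mul, key] at h1 h2
  apply hu'.mul_left_cancel
  linear_combination h1 - h2

theorem fsMap_partialAct (δ : CommDerivs k A n) (f : Fin p → A) (i : Fin n) (g : FS f) :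
    fsMap B f (partialAct δ f i g) = partialAct (δ.loc M B) _ i (fsMap B f g) := by
  rw [partialAct_apply, partialAct_apply, map_add, map_mul]
  congr 1
  · ext m
    change coeff m (MvPolynomial.map (invMap B f) (coeffMap _ g))
      = coeff m (coeffMap _ (MvPolynomial.map (invMap B f) g))
    rw [coeff_map, coeff_coeffMap, coeff_coeffMap, coeff_map, invMap_invDerivs M B]
  · congr 1
    simp only [logDerivFS, map_sum, map_mul, fsMap, map_X, map_C, invMap_algebraMap, invMap_fInv]
    refine Finset.sum_congr rfl fun j _ => ?_
    rw [← locDeriv_algebraMap M B (δ.d i) (f j)]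
    rfl

/-- The preimage of `D_B[s] · F f^s` contains `F f^s` and is stable under `A`, `k[s]` and the `∂ᵢ`.
-/
theorem fsMap_mem_bsModule {δ : CommDerivs k A n} {f : Fin p → A} {g : FS f}
    (hg : g ∈ bsModule δ f) : fsMap B f g ∈ bsModule (δ.loc M B) fun j => algebraMap A B (f j) := by
  refine bsModule_le δ f
    ((bsModule (δ.loc M B) fun j => algebraMap A B (f j)).toAddSubmonoid.comap
      (fsMap B f : FS f →+ _)) ?_ ?_ ?_ ?_ hg
  · change fsMap B f _ ∈ bsModule _ _
    rw [fsMap_F]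
    exact F_mem_bsModule _ _
  · intro a g (hg : fsMap B f g ∈ bsModule _ _)
    change fsMap B f _ ∈ bsModule _ _
    rw [map_mul, fsMap_C]
    exact C_mul_mem_bsModule _ hg
  · intro b g (hg : fsMap B f g ∈ bsModule _ _)
    change fsMap B f _ ∈ bsModule _ _
    rw [map_mul, fsMap_polyS]
    exact polyS_mul_mem_bsModule _ hg
  · intro i g (hg : fsMap B f g ∈ bsModule _ _)
    change fsMap B f _ ∈ bsModule _ _
    rw [fsMap_partialAct M B]
    exact partialAct_mem_bsModule _ hg

theorem bsIdeal_le_loc (δ : CommDerivs k A n) (f : Fin p → A) :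
    bsIdeal δ f ≤ bsIdeal (δ.loc M B) fun j => algebraMap A B (f j) := by
  intro b hb
  rw [mem_bsIdeal, ← fsMap_polyS]
  exact fsMap_mem_bsModule M B hb

/-- Clearing denominators: the elements `w` of `B[1/F, s] f^s` such that `h w` comes from
`D_A[s] · F f^s` for some `h ∈ M`. -/
def clearedSubmonoid (δ : CommDerivs k A n) (f : Fin p → A) :
    AddSubmonoid (FS fun j => algebraMap A B (f j)) where
  carrier := {w | ∃ h ∈ M, ∃ v ∈ bsModule δ f,
    fsMap B f v = C (algebraMap B _ (algebraMap A B h)) * w}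
  zero_mem' := ⟨1, M.one_mem, 0, zero_mem _, by simp⟩
  add_mem' := by
    rintro w w' ⟨h, hh, v, hv, e⟩ ⟨h', hh', v', hv', e'⟩
    -- Common denominator: `h h' (w + w') = h' (h w) + h (h' w')`.
    refine ⟨h * h', M.mul_mem hh hh', C (algebraMap A (InvF f) h') * v
      + C (algebraMap A (InvF f) h) * v',
      add_mem (C_mul_mem_bsModule _ hv) (C_mul_mem_bsModule _ hv'), ?_⟩
    simp only [map_add, map_mul, fsMap_C, e, e']
    ring

/-- The elements with a denominator in `M` are stable under all generators of `D_B[s]`; only `B` and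
the `∂ᵢ` force the denominator to change. -/
theorem exists_clear_denom {δ : CommDerivs k A n} {f : Fin p → A}
    {w : FS fun j => algebraMap A B (f j)} (hw : w ∈ bsModule (δ.loc M B) _) :
    ∃ h ∈ M, ∃ v ∈ bsModule δ f, fsMap B f v = C (algebraMap B _ (algebraMap A B h)) * w := by
  refine bsModule_le (δ.loc M B) _ (clearedSubmonoid M B δ f) ?_ ?_ ?_ ?_ hw
  · exact ⟨1, M.one_mem, _, F_mem_bsModule δ f, by rw [fsMap_F]; simp⟩
  · rintro b w ⟨h, hh, v, hv, e⟩
    obtain ⟨⟨a, u⟩, hu⟩ := IsLocalization.surj M b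
    -- With `b = a / u`, one has `u h (b w) = a (h w)`.
    refine ⟨u * h, M.mul_mem u.2 hh, _, C_mul_mem_bsModule a hv, ?_⟩
    rw [map_mul, fsMap_C, e, ← hu]
    simp only [map_mul]
    ring
  · rintro b w ⟨h, hh, v, hv, e⟩
    refine ⟨h, hh, _, polyS_mul_mem_bsModule b hv, ?_⟩
    rw [map_mul, fsMap_polyS, e]
    ring
  · rintro i w ⟨h, hh, v, hv, e⟩
    -- Quotient rule: `h² ∂ᵢ w = h ∂ᵢ(h w) - ∂ᵢ(h) (h w)`, and `h w` is the image of `v`.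
    refine ⟨h * h, M.mul_mem hh hh, _, sub_mem (C_mul_mem_bsModule h
      (partialAct_mem_bsModule i hv)) (C_mul_mem_bsModule (δ.d i h) hv), ?_⟩
    have hd : (δ.loc M B).d i (algebraMap A B h) = algebraMap A B (δ.d i h) :=
      locDeriv_algebraMap M B (δ.d i) h
    rw [map_sub, map_mul, map_mul, fsMap_partialAct M B, fsMap_C, fsMap_C, e, partialAct_C_mul, hd]
    simp only [map_mul]
    ring

theorem exists_mem_denomIdeal (hinj : Function.Injective (algebraMap A B))
    {δ : CommDerivs k A n} {f : Fin p → A} {b : MvPolynomial (Fin p) k}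
    (hb : b ∈ bsIdeal (δ.loc M B) fun j => algebraMap A B (f j)) :
    ∃ h ∈ M, h ∈ denomIdeal δ f b := by
  obtain ⟨h, hh, v, hv, e⟩ := exists_clear_denom M B (mem_bsIdeal.1 hb)
  refine ⟨h, hh, mem_denomIdeal.2 ?_⟩
  rw [← fsMap_polyS, ← fsMap_C, ← map_mul] at e
  -- Injectivity descends the identity from `B[1/F, s]`: `v` is `h b f^s` itself.
  rwa [← MvPolynomial.map_injective _ (invMap_injective B f hinj) e]

end BaseChange

/-! ### From points of `kⁿ` to the global statement -/

/-- The weak Nullstellensatz: an ideal that lies in no `idealAt a` is the unit ideal. -/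
theorem eq_top_of_forall_not_le_idealAt {k : Type*} [Field k] [IsAlgClosed k] {n : ℕ}
    (I : Ideal (MvPolynomial (Fin n) k)) (h : ∀ a : Fin n → k, ¬ I ≤ idealAt a) : I = ⊤ := by
  by_contra hI
  obtain ⟨m, hm, hIm⟩ := I.exists_le_maximal hI
  -- As `k` is algebraically closed, every maximal ideal is that of a point.
  obtain ⟨a, rfl⟩ := (MvPolynomial.isMaximal_iff_eq_vanishingIdeal_singleton (I := m)).1 hm
  refine h a (hIm.trans fun q hq => ?_)
  simpa [MvPolynomial.mem_vanishingIdeal_singleton_iff] using hq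

end BernsteinSato

end

theorem corollary1p6 {k : Type*} [Field k] [CharZero k] [IsAlgClosed k] {n p : ℕ}
    (hn : 1 ≤ n) (hp : 1 ≤ p) (f : Fin p → MvPolynomial (Fin n) k) :
    BernsteinSato.bsGlob f = ⨅ a : Fin n → k, BernsteinSato.bsLoc f a := by
  open BernsteinSato in
  apply le_antisymm
  · exact le_iInf fun a => bsIdeal_le_loc (idealAt a).primeCompl (LocRing a) (partials k n) f
  · intro b hb
    refine denomIdeal_eq_top.1 (eq_top_of_forall_not_le_idealAt _ fun a ha => ?_)
    obtain ⟨h, hh, hhI⟩ := exists_mem_denomIdeal (idealAt a).primeCompl (LocRing a)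
      -- `k[x]` is a domain, so it embeds in `k[x]_a`.
      (IsLocalization.injective _ (idealAt a).primeCompl_le_nonZeroDivisors)
      (Ideal.mem_iInf.1 hb a)
    -- `hh` says `h(a) ≠ 0`, whereas `ha` would force `h(a) = 0`.
    exact hh (ha hhI)
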